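/- Let $N\ge 1$ and $d\ge 0$ be integers, let $\mathcal A$ be any set, and for $a\in\mathcal A$ let $A_0(a),\dots,A_d(a)$ be complex $N\times N$ matrices and $\nu_a\in\mathbb R^{1+d}$, all bounded uniformly in $a$. Put $L(a,\zeta)=\sum_{j=0}^d\zeta_jA_j(a)$ for $\zeta\in\mathbb C^{1+d}$. Matrix norms are operator norms, and $(\cdot,\cdot)$ is the Hermitian scalar product of $\mathbb C^N$. **Definitions.** * For a matrix $B$, $L(a,\cdot)+B$ is *hyperbolic in the direction* $\nu$ if $p(\zeta)=\det(iL(a,\zeta)+B)$ satisfies: $\det(iL(a,\nu))\neq0$, and there is $\gamma_0$ such that $p(i\tau\nu+\xi)\ne0$ for all $\xi\in\mathbb R^{1+d}$ and all real $\tau$ with $|\tau|>\gamma_0$. "$L(a,\cdot)$ is hyperbolic" refers to $B=0$. * The family $L(a,\cdot)$ is *uniformly strongly hyperbolic in the direction* $\nu_a$ if $\inf_{a}|\det L(a,\nu_a)|>0$ and there is a constant $C$ such that for all $a\in\mathcal A$, all $\xi\in\mathbb R^{1+d}$ and all complex $N\times N$ matrices $B$, every root $\lambda\in\mathbb C$ of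 $\det(L(a,\xi+\lambda\nu_a)+B)=0$ satisfies $|\mathrm{Im}\,\lambda|\le C|B|$ (so that $L(a,\cdot)+B$ is hyperbolic for every $B$, with $\gamma_0=C|B|$). * Let $E$ be a linear subspace of $\mathbb R^{1+d}$ with $\mathbb R^{1+d}=E\oplus\mathbb R\nu_a$ for all $a$. A *uniform family of symmetrizers* (on $E$) is a family of matrices $S(a,\xi)$, $a\in\mathcal A$, $\xi\in E\setminus\{0\}$, bounded uniformly in $(a,\xi)$, (positively) homogeneous of degree $0$ in $\xi$, such that $S(a,\xi)L(a,\xi)$ and $S(a,\xi)L(a,\nu_a)$ are self-adjoint, and such that for some $c>0$ independent of $a$ one has $(S(a,\xi)L(a,\nu_a)u,u)\ge c|u|^2$ for all $a$, all $\xi\in E\setminus\{0\}$ and all $u\in\mathbb C^N$. * A *bounded family of full symmetrizers, uniformly positive in the direction* $\nu_a$, is a family of matrices $\mathbf S(a,\xi)$, $a\in\mathcal A$, $\xi\in\mathbb R^{1+d}\setminus\{0\}$, bounded uniformly in $(a,\xi)$, (positively) homogeneous of degree $0$ in $\xi$, such that $\mathbf S(a,\xi)L(a,\xi)$ is self-adjoint,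 and such that for some $c>0$ independent of $a$ one has $\mathrm{Re}\,(\mathbf S(a,\xi)L(a,\nu_a)u,u)\ge c|u|^2$ for all $a$, all $\xi\neq0$ and all $u\in\ker L(a,\xi)$. **Theorem.** (i) Suppose $d\ge1$, and let $E$ be a linear subspace of $\mathbb R^{1+d}$ such that $\mathbb R^{1+d}=E\oplus\mathbb R\nu_a$ for all $a\in\mathcal A$ and such that there is a compact set $K$ with $K\cap E=\emptyset$ and $\nu_a\in K$ for all $a\in\mathcal A$. Then $L(a,\cdot)$ is uniformly strongly hyperbolic in the direction $\nu_a$ if and only if there exists a uniform family of symmetrizers $S(a,\cdot)$ on $E$. (ii) $L(a,\cdot)$ is uniformly strongly hyperbolic in the direction $\nu_a$ if and only if both of the following hold: a) for every $a\in\mathcal A$, $L(a,\cdot)$ is hyperbolic in the direction $\nu_a$, and $\inf_{a\in\mathcal A}|\det L(a,\nu_a)|>0$; b) there exists a bounded family of full symmetrizers $\mathbf S(a,\cdot)$ which is uniformly positive in the direction $\nu_a$. -/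

import Mathlib

open scoped Matrix.Norms.L2Operator

namespace StrongHyp

noncomputable section

/-- `L(ζ) = ∑ j, ζ_j A_j` for a complex covector `ζ`; the coefficients `A_0, …, A_d` are
complex `N × N` matrices. Matrices carry the operator norm of the Euclidean (Hermitian) norm. -/
def symbol {N d : ℕ} (A : Fin (d + 1) → Matrix (Fin N) (Fin N) ℂ) (ζ : Fin (d + 1) → ℂ) :
    Matrix (Fin N) (Fin N) ℂ :=
  ∑ j, ζ j • A j

/-- `L(ξ)` for a real covector `ξ ∈ ℝ^{1+d}`. -/
def realSymbol {N d : ℕ} (A : Fin (d + 1) → Matrix (Fin N) (Fin N) ℂ)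
    (ξ : EuclideanSpace ℝ (Fin (d + 1))) : Matrix (Fin N) (Fin N) ℂ :=
  symbol A (fun j => (ξ j : ℂ))

/-- The characteristic determinant `p(ζ) = det (∑ j, i ζ_j A_j + B)` of `∑ j, A_j ∂_j + B`. -/
def charDet {N d : ℕ} (A : Fin (d + 1) → Matrix (Fin N) (Fin N) ℂ)
    (B : Matrix (Fin N) (Fin N) ℂ) (ζ : Fin (d + 1) → ℂ) : ℂ :=
  (symbol A (fun j => Complex.I * ζ j) + B).det

/-- `∑ j, A_j ∂_j + B` is hyperbolic in the direction `ν`: the principal part of the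
characteristic determinant does not vanish at `ν`, and for some `γ₀` one has
`p(i τ ν + ξ) ≠ 0` for all real `ξ` and all real `τ` with `|τ| > γ₀`. -/
def IsHyperbolic {N d : ℕ} (A : Fin (d + 1) → Matrix (Fin N) (Fin N) ℂ)
    (B : Matrix (Fin N) (Fin N) ℂ) (ν : EuclideanSpace ℝ (Fin (d + 1))) : Prop :=
  charDet A 0 (fun j => (ν j : ℂ)) ≠ 0 ∧
    ∃ γ₀ : ℝ, ∀ (ξ : EuclideanSpace ℝ (Fin (d + 1))) (τ : ℝ), γ₀ < |τ| →
      charDet A B (fun j => Complex.I * (τ : ℂ) * (ν j : ℂ) + (ξ j : ℂ)) ≠ 0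

/-- `inf_a |det L(a, ν_a)| > 0`. -/
def DetBoundedBelow {N d : ℕ} {𝒜 : Type*} (A : 𝒜 → Fin (d + 1) → Matrix (Fin N) (Fin N) ℂ)
    (ν : 𝒜 → EuclideanSpace ℝ (Fin (d + 1))) : Prop :=
  ∃ c : ℝ, 0 < c ∧ ∀ a, c ≤ ‖(realSymbol (A a) (ν a)).det‖

/-- The family `L(a, ·)` is uniformly strongly hyperbolic in the direction `ν_a`:
`|det L(a, ν_a)|` is bounded below, and there is one constant `C` such that, for all `a`, all real
`ξ` and *all* matrices `B`, the roots `λ` of `det (L(a, ξ + λ ν_a) + B) = 0` lie in the strip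
`|Im λ| ≤ C |B|`. The second condition says that `L(a, ·) + B` is hyperbolic for every `B`, with
`γ₀ = C |B|`. -/
def UniformlyStronglyHyperbolic {N d : ℕ} {𝒜 : Type*}
    (A : 𝒜 → Fin (d + 1) → Matrix (Fin N) (Fin N) ℂ)
    (ν : 𝒜 → EuclideanSpace ℝ (Fin (d + 1))) : Prop :=
  DetBoundedBelow A ν ∧
    ∃ C : ℝ, ∀ (a : 𝒜) (ξ : EuclideanSpace ℝ (Fin (d + 1))) (B : Matrix (Fin N) (Fin N) ℂ)
      (l : ℂ), (symbol (A a) (fun j => (ξ j : ℂ) + l * (ν a j : ℂ)) + B).det = 0 →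
        |l.im| ≤ C * ‖B‖

/-- `Re (M u, u)` for the Hermitian scalar product of `ℂ^N`. -/
def reForm {N : ℕ} (M : Matrix (Fin N) (Fin N) ℂ) (u : EuclideanSpace ℂ (Fin N)) : ℝ :=
  (inner ℂ u (Matrix.toEuclideanLin M u)).re

/-- `S` is a full symmetrizer for `L`, bounded by `M` and positive in the direction `ν` with
constant `c`. Only the values of `S` on `ℝ^{1+d} ∖ {0}` matter. -/
structure IsFullSymmetrizer {N d : ℕ} (A : Fin (d + 1) → Matrix (Fin N) (Fin N) ℂ)
    (ν : EuclideanSpace ℝ (Fin (d + 1))) (M c : ℝ)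
    (S : EuclideanSpace ℝ (Fin (d + 1)) → Matrix (Fin N) (Fin N) ℂ) : Prop where
  bounded : ∀ ξ, ξ ≠ 0 → ‖S ξ‖ ≤ M
  homogeneous : ∀ ξ, ξ ≠ 0 → ∀ t : ℝ, 0 < t → S (t • ξ) = S ξ
  selfAdjoint : ∀ ξ, ξ ≠ 0 → (S ξ * realSymbol A ξ).IsHermitian
  positive : ∀ ξ, ξ ≠ 0 → ∀ u : EuclideanSpace ℂ (Fin N),
    Matrix.toEuclideanLin (realSymbol A ξ) u = 0 → c * ‖u‖ ^ 2 ≤ reForm (S ξ * realSymbol A ν) u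

/-- A bounded family of full symmetrizers, uniformly positive in the direction `ν_a`. -/
def IsUniformFullSymmetrizerFamily {N d : ℕ} {𝒜 : Type*}
    (A : 𝒜 → Fin (d + 1) → Matrix (Fin N) (Fin N) ℂ)
    (ν : 𝒜 → EuclideanSpace ℝ (Fin (d + 1)))
    (S : 𝒜 → EuclideanSpace ℝ (Fin (d + 1)) → Matrix (Fin N) (Fin N) ℂ) : Prop :=
  ∃ M c : ℝ, 0 < c ∧ ∀ a, IsFullSymmetrizer (A a) (ν a) M c (S a)

/-- `E` is a common complement of all the lines `ℝ ν_a`, and the `ν_a` stay in a compact set which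
does not meet `E`. -/
def UniformDecomposition {d : ℕ} {𝒜 : Type*} (ν : 𝒜 → EuclideanSpace ℝ (Fin (d + 1)))
    (E : Submodule ℝ (EuclideanSpace ℝ (Fin (d + 1)))) : Prop :=
  (∀ a, IsCompl E (Submodule.span ℝ {ν a})) ∧
    ∃ K : Set (EuclideanSpace ℝ (Fin (d + 1))), IsCompact K ∧ (∀ a, ν a ∈ K) ∧
      K ∩ (E : Set (EuclideanSpace ℝ (Fin (d + 1)))) = ∅

/-- `S` is a symmetrizer for `L` in the direction `ν`, as a function of the frequencies
`ξ ∈ E ∖ {0}`, bounded by `M` and positive with constant `c`. -/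
structure IsSymmetrizer {N d : ℕ} (A : Fin (d + 1) → Matrix (Fin N) (Fin N) ℂ)
    (ν : EuclideanSpace ℝ (Fin (d + 1))) (E : Submodule ℝ (EuclideanSpace ℝ (Fin (d + 1))))
    (M c : ℝ) (S : E → Matrix (Fin N) (Fin N) ℂ) : Prop where
  bounded : ∀ ξ, ξ ≠ 0 → ‖S ξ‖ ≤ M
  homogeneous : ∀ ξ, ξ ≠ 0 → ∀ t : ℝ, 0 < t → S (t • ξ) = S ξ
  selfAdjoint : ∀ ξ, ξ ≠ 0 → (S ξ * realSymbol A ξ).IsHermitian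
  selfAdjoint_direction : ∀ ξ, ξ ≠ 0 → (S ξ * realSymbol A ν).IsHermitian
  positive : ∀ ξ, ξ ≠ 0 → ∀ u : EuclideanSpace ℂ (Fin N),
    c * ‖u‖ ^ 2 ≤ reForm (S ξ * realSymbol A ν) u

/-- A uniform (bounded, uniformly positive) family of symmetrizers for `{L(a, ·), ν_a}`. -/
def IsUniformSymmetrizerFamily {N d : ℕ} {𝒜 : Type*}
    (A : 𝒜 → Fin (d + 1) → Matrix (Fin N) (Fin N) ℂ)
    (ν : 𝒜 → EuclideanSpace ℝ (Fin (d + 1)))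
    (E : Submodule ℝ (EuclideanSpace ℝ (Fin (d + 1))))
    (S : 𝒜 → E → Matrix (Fin N) (Fin N) ℂ) : Prop :=
  ∃ M c : ℝ, 0 < c ∧ ∀ a, IsSymmetrizer (A a) (ν a) E M c (S a)

end

end StrongHyp

/-! Everything passes through one resolvent estimate, called (R) here: |Im l| |u| ≤ C |(L(a,ξ) + l
L(a,ν_a))u| with C independent of a, ξ, l and u. Making X singular by adding B costs at least the
minimum of |Xu|/|u|, and a rank one B attains this cost. Hence root bounds for all B amount to (R),
as in `uniformlyStronglyHyperbolic_iff`.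

Fix a and ξ, and put f = L(ν)⁻¹L(ξ). Then (R) forces f to be diagonalizable with real eigenvalues
and bounds its spectral projections P_μ. So T = ∑ P_μ* P_μ is a bounded positive matrix with T f
self-adjoint, and S = T L(ν)⁻¹ is the symmetrizer wanted in (i) and in (ii)
(`exists_pencil_symmetrizer`). No regularity in ξ is asked for, so choosing S pointwise suffices.

Conversely, a symmetrizer gives (R) through the imaginary part of (S(L(ξ) + l L(ν))u, u). Full
symmetrizers are weaker at each point, but they are available at all the points ξ - rν of the real
line through ξ, so there is one for each eigenvalue of f. Hyperbolicity makes these eigenvalues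
real, the full symmetrizers exclude Jordan blocks and bound each P_μ, and (R) follows by decomposing
u into eigenvectors (`resolvent_bound_of_symmetrizers`). -/

namespace StrongHyp

/-! ### Resolvent bounds, spectral projections and symmetrizers for one operator. -/

section Spectral

variable {V : Type*} [NormedAddCommGroup V] [InnerProductSpace ℂ V]

/-- A resolvent bound excludes Jordan blocks at real eigenvalues, and excludes nonreal
eigenvalues. -/
theorem eigenvector_of_resolvent_bound {f : V →L[ℂ] V} {K : ℝ}
    (hK : ∀ (l : ℂ) (u : V), |l.im| * ‖u‖ ≤ K * ‖f u + l • u‖) (μ : ℂ) (w : V)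
    (hw : f (f w - μ • w) = μ • (f w - μ • w)) : f w = μ • w := by
  set u := f w - μ • w with hu
  by_contra hne
  have hu0 : 0 < ‖u‖ := norm_pos_iff.2 (sub_ne_zero.2 hne)
  have him : μ.im = 0 := by
    have := hK (-μ) u
    rw [hw, neg_smul, add_neg_cancel, norm_zero, mul_zero, Complex.neg_im, abs_neg] at this
    have h2 : |μ.im| ≤ 0 := by
      by_contra h
      exact absurd this (not_le.2 (mul_pos (not_le.1 h) hu0))
    exact abs_eq_zero.1 (le_antisymm h2 (abs_nonneg _))
  -- The test vector w - itu with l = -μ - i/t is tuned so that the terms in u cancel and (f + l)(w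
  -- - itu) = -(i/t)w. The bound then controls t|u| for every t, which is absurd for large t.
  have key : ∀ t : ℝ, 0 < t → t * ‖u‖ ≤ (|K| + 1) * ‖w‖ := by
    intro t ht
    have h1 := hK (-μ - (t⁻¹ : ℝ) * Complex.I) (w - ((t : ℂ) * Complex.I) • u)
    have hi : (-μ - (t⁻¹ : ℝ) * Complex.I).im = -t⁻¹ := by simp [him]
    have htc : (t : ℂ) ≠ 0 := by exact_mod_cast ht.ne'
    have hv : f (w - ((t : ℂ) * Complex.I) • u) +
        (-μ - (t⁻¹ : ℝ) * Complex.I) • (w - ((t : ℂ) * Complex.I) • u) =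
        -(((t⁻¹ : ℝ) : ℂ) * Complex.I) • w := by
      have hfw : f w = u + μ • w := by rw [hu]; abel
      rw [map_sub, map_smul, hw, hfw]
      have h3 : ((t⁻¹ : ℝ) : ℂ) * Complex.I * ((t : ℂ) * Complex.I) = -1 := by
        push_cast
        field_simp
        simp
      have h4 : (((t⁻¹ : ℝ) : ℂ) * Complex.I * ((t : ℂ) * Complex.I)) • u = -u := by
        rw [h3, neg_one_smul]
      linear_combination (norm := module) h4
    rw [hi, hv, norm_smul, norm_neg, norm_mul, Complex.norm_I, mul_one, Complex.norm_real,
      Real.norm_eq_abs, abs_neg] at h1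
    have hpos : 0 < |t⁻¹| := abs_pos.2 (inv_pos.2 ht).ne'
    have h4 : ‖w - ((t : ℂ) * Complex.I) • u‖ ≤ K * ‖w‖ := by
      refine le_of_mul_le_mul_left ?_ hpos
      linarith
    have h5 : t * ‖u‖ = ‖((t : ℂ) * Complex.I) • u‖ := by
      rw [norm_smul, norm_mul, Complex.norm_I, mul_one, Complex.norm_real, Real.norm_of_nonneg ht.le]
    have h6 : ‖((t : ℂ) * Complex.I) • u‖ ≤ ‖w - ((t : ℂ) * Complex.I) • u‖ + ‖w‖ := by
      have := norm_sub_le w (w - ((t : ℂ) * Complex.I) • u)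
      rw [sub_sub_cancel] at this
      linarith
    have h7 : K * ‖w‖ ≤ |K| * ‖w‖ := mul_le_mul_of_nonneg_right (le_abs_self K) (norm_nonneg _)
    linarith
  have h8 := key (((|K| + 1) * ‖w‖ + 1) / ‖u‖) (by positivity)
  rw [div_mul_cancel₀ _ hu0.ne'] at h8
  linarith

/-- A resolvent bound controls the spectral projections. -/
theorem norm_spectral_projection_le {f : V →L[ℂ] V} {K : ℝ}
    (hK : ∀ (l : ℂ) (u : V), |l.im| * ‖u‖ ≤ K * ‖f u + l • u‖)
    {s : Finset ℂ} {P : ℂ → V →L[ℂ] V} (hsum : ∀ v, ∑ μ ∈ s, P μ v = v)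
    (hP : ∀ μ ∈ s, ∀ v, f (P μ v) = μ • P μ v) (hreal : ∀ μ ∈ s, μ.im = 0)
    {μ : ℂ} (hμ : μ ∈ s) (v : V) : ‖P μ v‖ ≤ K * ‖v‖ := by
  classical
  -- This is the rescaled resolvent t (f - μ + it)⁻¹ v. It is bounded by K|v|, and as t → 0⁺ only
  -- the component at μ survives, with coefficient -i.
  let x : ℝ → V := fun t => ∑ κ ∈ s, ((t : ℂ) / (κ - μ + t * Complex.I)) • P κ v
  have hne : ∀ κ ∈ s, ∀ t : ℝ, 0 < t → κ - μ + t * Complex.I ≠ 0 := by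
    intro κ hκ t ht h
    have := congrArg Complex.im h
    simp [hreal κ hκ, hreal μ hμ] at this
    exact ht.ne' this
  have hbound : ∀ t : ℝ, 0 < t → ‖x t‖ ≤ K * ‖v‖ := by
    intro t ht
    have h1 := hK (-μ + t * Complex.I) (x t)
    have hi : (-μ + t * Complex.I).im = t := by simp [hreal μ hμ]
    have hv : f (x t) + (-μ + t * Complex.I) • x t = (t : ℂ) • v := by
      conv_rhs => rw [← hsum v]
      simp only [x, map_sum, map_smul, Finset.smul_sum]
      rw [← Finset.sum_add_distrib]
      refine Finset.sum_congr rfl fun κ hκ => ?_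
      rw [hP κ hκ, smul_smul, smul_smul, ← add_smul]
      congr 1
      field_simp [hne κ hκ t ht]
      ring
    rw [hi, hv, norm_smul, Complex.norm_real, Real.norm_eq_abs] at h1
    refine le_of_mul_le_mul_left ?_ (abs_pos.2 ht.ne')
    linarith
  have hlim : Filter.Tendsto x (nhdsWithin 0 (Set.Ioi 0)) (nhds (-Complex.I • P μ v)) := by
    have h0 : -Complex.I • P μ v = ∑ κ ∈ s, (if κ = μ then -Complex.I else 0) • P κ v := by
      simp [ite_smul, hμ]
    rw [h0]
    refine tendsto_finsetSum _ fun κ hκ => Filter.Tendsto.smul_const ?_ _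
    by_cases h : κ = μ
    · subst h
      rw [if_pos rfl]
      refine tendsto_const_nhds.congr' ?_
      filter_upwards [self_mem_nhdsWithin] with t ht
      have : (t : ℂ) ≠ 0 := by exact_mod_cast (Set.mem_Ioi.1 ht).ne'
      rw [sub_self, zero_add, div_mul_eq_div_div, div_self this, one_div, Complex.inv_I]
    · rw [if_neg h]
      refine Filter.Tendsto.mono_left ?_ nhdsWithin_le_nhds
      have hc : ContinuousAt (fun t : ℝ => (t : ℂ) / (κ - μ + t * Complex.I)) 0 := by
        refine ContinuousAt.div (by fun_prop) (by fun_prop) ?_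
        simpa using sub_ne_zero.2 h
      simpa [ContinuousAt] using hc
  have := le_of_tendsto hlim.norm (by
    filter_upwards [self_mem_nhdsWithin] with t ht using hbound t ht)
  simpa [norm_smul] using this

variable [FiniteDimensional ℂ V]

/-- An endomorphism without Jordan blocks is annihilated by the nodal polynomial of its
spectrum. -/
theorem aeval_nodal_charpoly_roots_eq_zero (f : Module.End ℂ V)
    (hf : ∀ (μ : ℂ) (w : V), f (f w - μ • w) = μ • (f w - μ • w) → f w = μ • w) :
    Polynomial.aeval f (Lagrange.nodal f.charpoly.roots.toFinset id) = 0 := by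
  -- The hypothesis says that ker (f - μ)² = ker (f - μ), so the chain of generalized eigenspaces
  -- stops at once. Over ℂ the eigenspaces therefore span, and the identity need only be checked on
  -- eigenvectors.
  have hmax : ∀ μ, f.maxGenEigenspace μ ≤ f.eigenspace μ := by
    intro μ v hv
    rw [Module.End.mem_maxGenEigenspace] at hv
    obtain ⟨k, hk⟩ := hv
    rw [Module.End.mem_eigenspace_iff]
    induction k generalizing v with
    | zero => simp_all
    | succ k ih =>
      rw [pow_succ, Module.End.mul_apply] at hk
      have := ih hk
      apply hf
      simpa using this
  have htop : ⨆ μ, f.eigenspace μ = ⊤ := by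
    rw [eq_top_iff, ← f.iSup_maxGenEigenspace_eq_top]
    exact iSup_mono hmax
  ext v
  have hv : v ∈ ⨆ μ, f.eigenspace μ := htop ▸ Submodule.mem_top
  induction hv using Submodule.iSup_induction' with
  | mem μ v hv =>
    by_cases h0 : v = 0
    · simp [h0]
    · have hev : f.HasEigenvector μ v := ⟨hv, h0⟩
      rw [Module.End.aeval_apply_of_hasEigenvector hev]
      have hμ : μ ∈ f.charpoly.roots.toFinset := by
        rw [Multiset.mem_toFinset, Polynomial.mem_roots f.charpoly_monic.ne_zero]
        exact (Module.End.hasEigenvalue_iff_isRoot_charpoly f μ).1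
          (Module.End.hasEigenvalue_of_hasEigenvector hev)
      have := Lagrange.eval_nodal_at_node (v := id) hμ
      rw [id] at this
      simp [this]
  | zero => simp
  | add x y _ _ hx hy => simp_all

/-- Spectral projections of an endomorphism without Jordan blocks. -/
theorem exists_spectral_projections (f : V →L[ℂ] V)
    (hf : ∀ (μ : ℂ) (w : V), f (f w - μ • w) = μ • (f w - μ • w) → f w = μ • w) :
    ∃ (s : Finset ℂ) (P : ℂ → V →L[ℂ] V), s.card ≤ Module.finrank ℂ V ∧
      (∀ v, ∑ μ ∈ s, P μ v = v) ∧ (∀ μ ∈ s, ∀ v, f (P μ v) = μ • P μ v) ∧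
      (∀ μ ∈ s, ∀ v, P μ (f v) = μ • P μ v) ∧ ∀ μ ∈ s, ∃ v, v ≠ 0 ∧ f v = μ • v := by
  set g : Module.End ℂ V := (f : V →ₗ[ℂ] V) with hg
  set s := g.charpoly.roots.toFinset with hs
  have hnodal : Polynomial.aeval g (Lagrange.nodal s id) = 0 :=
    aeval_nodal_charpoly_roots_eq_zero g hf
  have hmem : ∀ μ, μ ∈ s ↔ g.HasEigenvalue μ := by
    intro μ
    rw [hs, Multiset.mem_toFinset, Polynomial.mem_roots g.charpoly_monic.ne_zero,
      Module.End.hasEigenvalue_iff_isRoot_charpoly]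
  -- The projections are the Lagrange basis polynomials evaluated at f: multiplying one by X - μ
  -- gives a multiple of the nodal polynomial, which annihilates f.
  have hmul : ∀ μ ∈ s, Polynomial.aeval g
      ((Polynomial.X - Polynomial.C μ) * Lagrange.basis s id μ) = 0 := by
    intro μ hμ
    have h : (Polynomial.X - Polynomial.C μ) * Lagrange.basis s id μ =
        Polynomial.C (∏ j ∈ s.erase μ, (μ - j)⁻¹) * Lagrange.nodal s id := by
      rw [Lagrange.nodal_eq_mul_nodal_erase hμ, Lagrange.basis, Lagrange.nodal_eq]
      simp only [Lagrange.basisDivisor, Finset.prod_mul_distrib, id, map_prod]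
      ring
    rw [h, map_mul, hnodal, mul_zero]
  have hcomm : ∀ μ v, Polynomial.aeval g (Lagrange.basis s id μ) (g v) =
      g (Polynomial.aeval g (Lagrange.basis s id μ) v) := by
    intro μ v
    rw [← Module.End.mul_apply, ← Module.End.mul_apply]
    have := (Commute.all (Lagrange.basis s id μ) Polynomial.X).map (Polynomial.aeval g)
    rw [Polynomial.aeval_X] at this
    rw [this.eq]
  have heig : ∀ μ ∈ s, ∀ v, g (Polynomial.aeval g (Lagrange.basis s id μ) v) =
      μ • Polynomial.aeval g (Lagrange.basis s id μ) v := by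
    intro μ hμ v
    have := LinearMap.congr_fun (hmul μ hμ) v
    simp only [map_mul, map_sub, Polynomial.aeval_X, Polynomial.aeval_C, Module.End.mul_apply,
      LinearMap.sub_apply, LinearMap.zero_apply, Module.algebraMap_end_apply] at this
    exact sub_eq_zero.1 this
  refine ⟨s, fun μ => LinearMap.toContinuousLinearMap
    (Polynomial.aeval g (Lagrange.basis s id μ)), ?_, ?_, ?_, ?_, ?_⟩
  · exact (Multiset.toFinset_card_le _).trans
      ((Polynomial.card_roots' _).trans g.charpoly_natDegree.le)
  · intro v
    -- When V = 0 the spectrum is empty and the Lagrange polynomials sum to 0 rather than 1.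
    rcases subsingleton_or_nontrivial V with h | h
    · exact Subsingleton.elim _ _
    · have hne : s.Nonempty := by
        obtain ⟨μ, hμ⟩ := Module.End.exists_eigenvalue g
        exact ⟨μ, (hmem μ).2 hμ⟩
      have := congrArg (fun p => Polynomial.aeval g p v)
        (Lagrange.sum_basis (v := id) (Function.injective_id.injOn) hne)
      simpa using this
  · intro μ hμ v
    exact heig μ hμ v
  · intro μ hμ v
    exact (hcomm μ v).trans (heig μ hμ v)
  · intro μ hμ
    obtain ⟨v, hv⟩ := ((hmem μ).1 hμ).exists_hasEigenvector
    exact ⟨v, hv.2, Module.End.mem_eigenspace_iff.1 hv.1⟩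

/-- An endomorphism satisfying a resolvent bound is symmetrizable, with quantitative bounds. -/
theorem exists_symmetrizer_of_resolvent_bound {f : V →L[ℂ] V} {K : ℝ} (hK0 : 0 ≤ K)
    (hK : ∀ (l : ℂ) (u : V), |l.im| * ‖u‖ ≤ K * ‖f u + l • u‖) :
    ∃ T : V →L[ℂ] V, ‖T‖ ≤ Module.finrank ℂ V * K ^ 2 ∧ IsSelfAdjoint T ∧
      IsSelfAdjoint (T * f) ∧
      ∀ u, 1 / ((Module.finrank ℂ V : ℝ) + 1) * ‖u‖ ^ 2 ≤ (inner ℂ u (T u)).re := by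
  obtain ⟨s, P, hcard, hsum, hfP, hPf, hev⟩ :=
    exists_spectral_projections f (eigenvector_of_resolvent_bound hK)
  have hreal : ∀ μ ∈ s, μ.im = 0 := by
    intro μ hμ
    obtain ⟨v, hv0, hv⟩ := hev μ hμ
    have := hK (-μ) v
    rw [hv, neg_smul, add_neg_cancel, norm_zero, mul_zero, Complex.neg_im, abs_neg] at this
    by_contra h
    exact absurd this (not_le.2 (mul_pos (abs_pos.2 h) (norm_pos_iff.2 hv0)))
  have hPn : ∀ μ ∈ s, ‖P μ‖ ≤ K := fun μ hμ =>
    (P μ).opNorm_le_bound hK0 (norm_spectral_projection_le hK hsum hfP hreal hμ)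
  -- Since P_μ f = μ P_μ, composing with f only weights each term by its eigenvalue, which is real.
  have hTf : (∑ μ ∈ s, star (P μ) * P μ) * f = ∑ μ ∈ s, μ • (star (P μ) * P μ) := by
    rw [Finset.sum_mul]
    refine Finset.sum_congr rfl fun μ hμ => ?_
    ext v
    simp [hPf μ hμ]
  refine ⟨∑ μ ∈ s, star (P μ) * P μ, ?_, ?_, ?_, ?_⟩
  · calc ‖∑ μ ∈ s, star (P μ) * P μ‖ ≤ ∑ μ ∈ s, K ^ 2 := by
          refine norm_sum_le_of_le _ fun μ hμ => ?_
          rw [ContinuousLinearMap.star_eq_adjoint, ContinuousLinearMap.mul_def,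
            ContinuousLinearMap.norm_adjoint_comp_self, ← sq]
          exact pow_le_pow_left₀ (norm_nonneg _) (hPn μ hμ) 2
      _ = s.card * K ^ 2 := by rw [Finset.sum_const, nsmul_eq_mul]
      _ ≤ Module.finrank ℂ V * K ^ 2 := by gcongr
  · exact isSelfAdjoint_sum _ fun μ _ => IsSelfAdjoint.star_mul_self _
  · rw [hTf]
    refine isSelfAdjoint_sum _ fun μ hμ => ?_
    refine IsSelfAdjoint.smul ?_ (IsSelfAdjoint.star_mul_self _)
    exact Complex.conj_eq_iff_im.2 (hreal μ hμ)
  · intro u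
    have h1 : (inner ℂ u ((∑ μ ∈ s, star (P μ) * P μ) u)).re = ∑ μ ∈ s, ‖P μ u‖ ^ 2 := by
      rw [_root_.sum_apply, inner_sum, Complex.re_sum]
      refine Finset.sum_congr rfl fun μ _ => ?_
      rw [mul_apply_eq_comp, ContinuousLinearMap.star_eq_adjoint,
        ContinuousLinearMap.adjoint_inner_right]
      exact inner_self_eq_norm_sq (𝕜 := ℂ) _
    rw [h1, one_div, inv_mul_le_iff₀ (by positivity)]
    calc ‖u‖ ^ 2 ≤ (∑ μ ∈ s, ‖P μ u‖) ^ 2 := by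
          refine pow_le_pow_left₀ (norm_nonneg _) ?_ 2
          conv_lhs => rw [← hsum u]
          exact norm_sum_le _ _
      _ ≤ s.card * ∑ μ ∈ s, ‖P μ u‖ ^ 2 := sq_sum_le_card_mul_sum_sq
      -- The added 1 keeps the constant a genuine positive number in dimension 0.
      _ ≤ ((Module.finrank ℂ V : ℝ) + 1) * ∑ μ ∈ s, ‖P μ u‖ ^ 2 := by
          refine mul_le_mul_of_nonneg_right ?_ (Finset.sum_nonneg fun _ _ => sq_nonneg _)
          have : (s.card : ℝ) ≤ Module.finrank ℂ V := by exact_mod_cast hcard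
          linarith

/-- Symmetrizers which are positive on the eigenspaces yield a resolvent bound. -/
theorem resolvent_bound_of_symmetrizers {f : V →L[ℂ] V} {T : ℂ → V →L[ℂ] V} {M c : ℝ}
    (hM : 0 ≤ M) (hc : 0 < c) (hreal : ∀ (μ : ℂ) (v : V), v ≠ 0 → f v = μ • v → μ.im = 0)
    (hT : ∀ μ : ℂ, μ.im = 0 → ‖T μ‖ ≤ M)
    (hsymm : ∀ μ : ℂ, μ.im = 0 → ∀ v w : V,
      inner ℂ v (T μ (f w - μ • w)) = inner ℂ (T μ (f v - μ • v)) w)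
    (hpos : ∀ μ : ℂ, μ.im = 0 → ∀ v, f v = μ • v → c * ‖v‖ ^ 2 ≤ (inner ℂ v (T μ v)).re)
    (l : ℂ) (u : V) : |l.im| * ‖u‖ ≤ Module.finrank ℂ V * (M / c) * ‖f u + l • u‖ := by
  -- If u = (f - μ)w is an eigenvector, then (u, T u) = (u, T(f - μ)w) = (T(f - μ)u, w) = 0, against
  -- positivity.
  have hss : ∀ (μ : ℂ) (w : V), f (f w - μ • w) = μ • (f w - μ • w) → f w = μ • w := by
    intro μ w hw
    by_contra hne
    have h0 : f w - μ • w ≠ 0 := sub_ne_zero.2 hne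
    have hμ := hreal μ _ h0 hw
    have h1 := hpos μ hμ _ hw
    rw [hsymm μ hμ, hw, sub_self, map_zero, inner_zero_left, Complex.zero_re] at h1
    exact absurd h1 (not_le.2 (by have := norm_pos_iff.2 h0; positivity))
  obtain ⟨s, P, hcard, hsum, hfP, hPf, hev⟩ := exists_spectral_projections f hss
  have hs : ∀ μ ∈ s, μ.im = 0 := by
    intro μ hμ
    obtain ⟨v, hv0, hv⟩ := hev μ hμ
    exact hreal μ v hv0 hv
  have hPn : ∀ μ ∈ s, ∀ v, ‖P μ v‖ ≤ M / c * ‖v‖ := by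
    intro μ hμ v
    -- For κ ≠ μ, (κ - μ) P_κ v lies in the range of f - μ, while P_μ v lies in its kernel; the
    -- symmetry of T(f - μ) makes the cross term vanish. Hence c|P_μ v|² ≤ Re (P_μ v, T v) ≤ M |P_μ
    -- v| |v|.
    have horth : inner ℂ (P μ v) (T μ v) = inner ℂ (P μ v) (T μ (P μ v)) := by
      have h0 : inner ℂ (P μ v) (T μ v) = ∑ κ ∈ s, inner ℂ (P μ v) (T μ (P κ v)) := by
        rw [← inner_sum, ← map_sum, hsum]
      rw [h0]
      refine Finset.sum_eq_single_of_mem _ hμ ?_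
      intro κ hκ hκμ
      have h1 := hsymm μ (hs μ hμ) (P μ v) (P κ v)
      rw [hfP κ hκ, hfP μ hμ, sub_self, map_zero, inner_zero_left, ← sub_smul, map_smul,
        inner_smul_right] at h1
      exact (mul_eq_zero.1 h1).resolve_left (sub_ne_zero.2 hκμ)
    have h2 := hpos μ (hs μ hμ) _ (hfP μ hμ v)
    rw [← horth] at h2
    have h3 : (inner ℂ (P μ v) (T μ v)).re ≤ ‖P μ v‖ * (M * ‖v‖) :=
      (Complex.re_le_norm _).trans ((norm_inner_le_norm _ _).trans
        (mul_le_mul_of_nonneg_left ((T μ).le_of_opNorm_le (hT μ (hs μ hμ)) v) (norm_nonneg _)))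
    rcases (norm_nonneg (P μ v)).eq_or_lt with h0 | h0
    · rw [← h0]; positivity
    · rw [div_mul_eq_mul_div, le_div_iff₀ hc]
      refine le_of_mul_le_mul_left ?_ h0
      linarith
  calc |l.im| * ‖u‖ ≤ |l.im| * ∑ μ ∈ s, ‖P μ u‖ := by
        refine mul_le_mul_of_nonneg_left ?_ (abs_nonneg _)
        conv_lhs => rw [← hsum u]
        exact norm_sum_le _ _
    _ = ∑ μ ∈ s, |l.im| * ‖P μ u‖ := Finset.mul_sum ..
    _ ≤ ∑ μ ∈ s, M / c * ‖f u + l • u‖ := by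
        refine Finset.sum_le_sum fun μ hμ => (?_ : _ ≤ ‖P μ (f u + l • u)‖).trans (hPn μ hμ _)
        rw [map_add, map_smul, hPf μ hμ, ← add_smul, norm_smul]
        refine mul_le_mul_of_nonneg_right ?_ (norm_nonneg _)
        have := Complex.abs_im_le_norm (μ + l)
        rwa [Complex.add_im, hs μ hμ, zero_add] at this
    _ = s.card * (M / c * ‖f u + l • u‖) := by rw [Finset.sum_const, nsmul_eq_mul]
    _ ≤ Module.finrank ℂ V * (M / c * ‖f u + l • u‖) := by
        refine mul_le_mul_of_nonneg_right (by exact_mod_cast hcard) (by positivity)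
    _ = _ := by ring

end Spectral

/-! ### Operators of matrices, determinant bounds, and pencils L₁ + l L₀. -/

section MatrixBounds

variable {N : ℕ}

/-- The operator on the Hermitian space `ℂ^N` defined by a matrix. -/
noncomputable abbrev toOp (X : Matrix (Fin N) (Fin N) ℂ) :
    EuclideanSpace ℂ (Fin N) →L[ℂ] EuclideanSpace ℂ (Fin N) :=
  Matrix.toEuclideanCLM (n := Fin N) (𝕜 := ℂ) X

theorem norm_toOp_apply_le (X : Matrix (Fin N) (Fin N) ℂ) (u : EuclideanSpace ℂ (Fin N)) :
    ‖toOp X u‖ ≤ ‖X‖ * ‖u‖ :=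
  (toOp X).le_opNorm u

theorem toOp_mul_apply (X Y : Matrix (Fin N) (Fin N) ℂ) (u : EuclideanSpace ℂ (Fin N)) :
    toOp (X * Y) u = toOp X (toOp Y u) := by
  rw [toOp, map_mul]; rfl

theorem toOp_one : toOp (1 : Matrix (Fin N) (Fin N) ℂ) = 1 := map_one _

theorem toOp_add_smul_apply (X Y : Matrix (Fin N) (Fin N) ℂ) (l : ℂ)
    (u : EuclideanSpace ℂ (Fin N)) : toOp (X + l • Y) u = toOp X u + l • toOp Y u := by
  rw [toOp, map_add, map_smul]; rfl

theorem isSelfAdjoint_toOp_iff (X : Matrix (Fin N) (Fin N) ℂ) :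
    IsSelfAdjoint (toOp X) ↔ X.IsHermitian := by
  rw [IsSelfAdjoint, toOp, ← map_star]
  exact (EquivLike.injective (Matrix.toEuclideanCLM (n := Fin N) (𝕜 := ℂ))).eq_iff

theorem inner_toOp_of_isHermitian {X : Matrix (Fin N) (Fin N) ℂ} (hX : X.IsHermitian)
    (u v : EuclideanSpace ℂ (Fin N)) : inner ℂ u (toOp X v) = inner ℂ (toOp X u) v := by
  have h := (isSelfAdjoint_toOp_iff X).2 hX
  conv_rhs => rw [← h.star_eq, ContinuousLinearMap.star_eq_adjoint,
    ContinuousLinearMap.adjoint_inner_left]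

theorem im_inner_toOp_of_isHermitian {X : Matrix (Fin N) (Fin N) ℂ} (hX : X.IsHermitian)
    (u : EuclideanSpace ℂ (Fin N)) : (inner ℂ u (toOp X u)).im = 0 := by
  rw [← Complex.conj_eq_iff_im, inner_conj_symm, inner_toOp_of_isHermitian hX]

theorem det_eq_zero_iff_exists_toOp (X : Matrix (Fin N) (Fin N) ℂ) :
    X.det = 0 ↔ ∃ u : EuclideanSpace ℂ (Fin N), u ≠ 0 ∧ toOp X u = 0 := by
  rw [← Matrix.exists_mulVec_eq_zero_iff]
  constructor
  · rintro ⟨v, hv, h⟩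
    refine ⟨WithLp.toLp 2 v, by simpa using hv, ?_⟩
    rw [toOp, Matrix.toEuclideanCLM_toLp, h]
    rfl
  · rintro ⟨u, hu, h⟩
    refine ⟨u.ofLp, by simpa using hu, ?_⟩
    rw [← Matrix.ofLp_toEuclideanCLM, h]
    rfl

/-- Inverses of bounded matrices with determinant bounded below are bounded. -/
theorem exists_norm_inv_le (R c : ℝ) (hc : 0 < c) : ∃ G : ℝ, 0 ≤ G ∧
    ∀ X : Matrix (Fin N) (Fin N) ℂ, ‖X‖ ≤ R → c ≤ ‖X.det‖ → ‖X⁻¹‖ ≤ G := by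
  have : ProperSpace (Matrix (Fin N) (Fin N) ℂ) := FiniteDimensional.proper ℂ _
  -- X⁻¹ is the adjugate over the determinant, and the adjugate is continuous, hence bounded on a
  -- ball.
  obtain ⟨D, hD⟩ := (isCompact_closedBall (0 : Matrix (Fin N) (Fin N) ℂ)
    R).exists_bound_of_continuousOn (f := Matrix.adjugate) (continuous_id.matrix_adjugate).continuousOn
  refine ⟨c⁻¹ * |D|, by positivity, fun X hX hdet => ?_⟩
  rw [Matrix.inv_def, Ring.inverse_eq_inv', norm_smul, norm_inv]
  exact mul_le_mul (inv_anti₀ hc hdet)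
    ((hD X (by simpa using hX)).trans (le_abs_self D)) (norm_nonneg _) (by positivity)

/-- The determinant of a matrix which is bounded below as an operator is bounded below. -/
theorem exists_le_norm_det (N : ℕ) (K : ℝ) : ∃ c : ℝ, 0 < c ∧
    ∀ X : Matrix (Fin N) (Fin N) ℂ, (∀ u, ‖u‖ ≤ K * ‖toOp X u‖) → c ≤ ‖X.det‖ := by
  have : ProperSpace (Matrix (Fin N) (Fin N) ℂ) := FiniteDimensional.proper ℂ _
  -- The ball is meant for X⁻¹: a bound on det X⁻¹ is a lower bound on det X.
  obtain ⟨D, hD⟩ := (isCompact_closedBall (0 : Matrix (Fin N) (Fin N) ℂ)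
    |K|).exists_bound_of_continuousOn (f := Matrix.det) (continuous_id.matrix_det).continuousOn
  refine ⟨(|D| + 1)⁻¹, by positivity, fun X hX => ?_⟩
  have hdet : X.det ≠ 0 := by
    intro h
    obtain ⟨u, hu, h0⟩ := (det_eq_zero_iff_exists_toOp X).1 h
    have := hX u
    rw [h0, norm_zero, mul_zero] at this
    exact hu (norm_le_zero_iff.1 this)
  have hunit : IsUnit X.det := isUnit_iff_ne_zero.2 hdet
  have hinv : ‖X⁻¹‖ ≤ |K| := by
    refine (toOp X⁻¹).opNorm_le_bound (abs_nonneg K) fun u => ?_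
    have := hX (toOp X⁻¹ u)
    rw [← toOp_mul_apply, Matrix.mul_nonsing_inv X hunit, toOp_one] at this
    exact this.trans (mul_le_mul_of_nonneg_right (le_abs_self K) (norm_nonneg _))
  have h1 := hD X⁻¹ (by simpa using hinv)
  have h2 : ‖X.det‖ * ‖X⁻¹.det‖ = 1 := by
    rw [← norm_mul, ← Matrix.det_mul, Matrix.mul_nonsing_inv X hunit, Matrix.det_one, norm_one]
  rw [inv_le_iff_one_le_mul₀ (by positivity), ← h2]
  exact mul_le_mul_of_nonneg_left (h1.trans ((le_abs_self D).trans (by linarith))) (norm_nonneg _)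

/-- The distance to the singular matrices is attained on matrices of rank one. -/
theorem mul_norm_le_of_singular_perturbation {X : Matrix (Fin N) (Fin N) ℂ} {r C : ℝ}
    (h : ∀ B : Matrix (Fin N) (Fin N) ℂ, (X + B).det = 0 → r ≤ C * ‖B‖)
    (u : EuclideanSpace ℂ (Fin N)) : r * ‖u‖ ≤ C * ‖toOp X u‖ := by
  rcases eq_or_ne u 0 with rfl | hu
  · simp
  have hu0 : 0 < ‖u‖ := norm_pos_iff.2 hu
  -- Q sends v to -(u, v)|u|⁻² Xu, up to the convention for the scalar product, so that (X + Q)u = 0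
  -- and |Q| = |Xu|/|u|.
  let Q := InnerProductSpace.rankOne ℂ (toOp X u) ((-(‖u‖ : ℂ) ^ 2)⁻¹ • u)
  let B := (Matrix.toEuclideanCLM (n := Fin N) (𝕜 := ℂ)).symm Q
  have hB : toOp B = Q := StarAlgEquiv.apply_symm_apply _ _
  have hBn : ‖B‖ = ‖toOp X u‖ / ‖u‖ := by
    rw [← Matrix.l2_opNorm_toEuclideanCLM, show Matrix.toEuclideanCLM (n := Fin N) (𝕜 := ℂ) B = Q from hB,
      InnerProductSpace.norm_rankOne, norm_smul, norm_inv,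
      norm_neg, norm_pow, Complex.norm_real, norm_norm]
    field_simp
  have hc : (‖u‖ : ℂ) ≠ 0 := by exact_mod_cast hu0.ne'
  have h1 := h B ((det_eq_zero_iff_exists_toOp _).2 ⟨u, hu, by
    have : toOp (X + B) u = toOp X u + toOp B u := by rw [toOp, map_add]; rfl
    rw [this, hB, InnerProductSpace.rankOne_apply, inner_smul_left, inner_self_eq_norm_sq_to_K,
      map_inv₀, map_neg, map_pow, Complex.conj_ofReal]
    have h2 : (-(‖u‖ : ℂ) ^ 2)⁻¹ * (‖u‖ : ℂ) ^ 2 = -1 := by field_simp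
    erw [h2]
    rw [neg_one_smul, add_neg_cancel]⟩)
  rwa [hBn, mul_div_assoc', le_div_iff₀ hu0] at h1

/-- A kernel vector of X + B satisfies |Xu| = |Bu| ≤ |B| |u|. This is the easy converse of the rank
one construction. -/
theorem le_mul_norm_of_singular_perturbation {X B : Matrix (Fin N) (Fin N) ℂ} {r C : ℝ}
    (hC : 0 ≤ C) (h : ∀ u, r * ‖u‖ ≤ C * ‖toOp X u‖) (hB : (X + B).det = 0) : r ≤ C * ‖B‖ := by
  obtain ⟨u, hu, h0⟩ := (det_eq_zero_iff_exists_toOp _).1 hB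
  have h1 : toOp X u = -toOp B u := by
    rw [toOp, map_add] at h0
    exact eq_neg_of_add_eq_zero_left h0
  have h2 := h u
  rw [h1, norm_neg] at h2
  refine le_of_mul_le_mul_right (h2.trans ?_) (norm_pos_iff.2 hu)
  rw [mul_assoc]
  exact mul_le_mul_of_nonneg_left (norm_toOp_apply_le B u) hC

/-- A pencil with a resolvent bound has a symmetrizer. -/
theorem exists_pencil_symmetrizer {L₀ L₁ : Matrix (Fin N) (Fin N) ℂ} {C R G : ℝ} (hC : 0 ≤ C)
    (hR : ‖L₀‖ ≤ R) (hG : ‖L₀⁻¹‖ ≤ G) (hdet : L₀.det ≠ 0)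
    (h : ∀ (l : ℂ) u, |l.im| * ‖u‖ ≤ C * ‖toOp (L₁ + l • L₀) u‖) :
    ∃ S : Matrix (Fin N) (Fin N) ℂ, ‖S‖ ≤ N * (C * R) ^ 2 * G ∧ (S * L₁).IsHermitian ∧
      (S * L₀).IsHermitian ∧ ∀ u, 1 / ((N : ℝ) + 1) * ‖u‖ ^ 2 ≤ reForm (S * L₀) u := by
  have hunit : IsUnit L₀.det := isUnit_iff_ne_zero.2 hdet
  have hR0 : 0 ≤ R := (norm_nonneg _).trans hR
  have hf : ∀ (l : ℂ) u, |l.im| * ‖u‖ ≤ C * R * ‖toOp (L₀⁻¹ * L₁) u + l • u‖ := by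
    intro l u
    refine (h l u).trans ?_
    have h1 : toOp (L₁ + l • L₀) u = toOp L₀ (toOp (L₀⁻¹ * L₁) u + l • u) := by
      rw [map_add, map_smul, ← toOp_mul_apply, Matrix.mul_nonsing_inv_cancel_left _ _ hunit,
        toOp_add_smul_apply]
    rw [h1, mul_assoc]
    refine mul_le_mul_of_nonneg_left ((norm_toOp_apply_le _ _).trans ?_) hC
    exact mul_le_mul_of_nonneg_right hR (norm_nonneg _)
  obtain ⟨T, hTn, hT, hTf, hpos⟩ := exists_symmetrizer_of_resolvent_bound (by positivity) hf
  rw [finrank_euclideanSpace_fin] at hTn hpos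
  obtain ⟨X, rfl⟩ : ∃ X, toOp X = T := ⟨_, StarAlgEquiv.apply_symm_apply _ T⟩
  change ‖X‖ ≤ _ at hTn
  have hX : X * L₀⁻¹ * L₀ = X := Matrix.nonsing_inv_mul_cancel_right _ _ hunit
  -- With X a symmetrizer of f = L₀⁻¹L₁, the choice S = X L₀⁻¹ gives S L₀ = X and S L₁ = X f.
  refine ⟨X * L₀⁻¹, ?_, ?_, ?_, ?_⟩
  · exact (Matrix.l2_opNorm_mul _ _).trans
      (mul_le_mul hTn hG (norm_nonneg _) (by positivity))
  · rw [Matrix.mul_assoc, ← isSelfAdjoint_toOp_iff, toOp, map_mul]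
    exact hTf
  · rw [hX]
    exact (isSelfAdjoint_toOp_iff X).1 hT
  · rw [hX]
    exact hpos

/-- A pencil with a symmetrizer satisfies a resolvent bound. -/
theorem pencil_resolvent_bound_of_symmetrizer {L₀ L₁ S : Matrix (Fin N) (Fin N) ℂ} {M c : ℝ}
    (hc : 0 < c) (hS : ‖S‖ ≤ M) (h₁ : (S * L₁).IsHermitian) (h₀ : (S * L₀).IsHermitian)
    (hpos : ∀ u, c * ‖u‖ ^ 2 ≤ reForm (S * L₀) u) (l : ℂ) (u : EuclideanSpace ℂ (Fin N)) :
    |l.im| * ‖u‖ ≤ M / c * ‖toOp (L₁ + l • L₀) u‖ := by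
  rcases eq_or_ne u 0 with rfl | hu
  · simp
  have hu0 : 0 < ‖u‖ := norm_pos_iff.2 hu
  -- Both S L₁ and S L₀ are Hermitian, so the only imaginary contribution comes from l.
  have him : (inner ℂ u (toOp S (toOp (L₁ + l • L₀) u))).im = l.im * reForm (S * L₀) u := by
    rw [toOp_add_smul_apply, map_add, map_smul, ← toOp_mul_apply, ← toOp_mul_apply, inner_add_right,
      inner_smul_right, Complex.add_im, Complex.mul_im, im_inner_toOp_of_isHermitian h₁,
      im_inner_toOp_of_isHermitian h₀, mul_zero, zero_add, zero_add]
    rfl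
  have h2 : |l.im| * (c * ‖u‖ ^ 2) ≤ ‖u‖ * (M * ‖toOp (L₁ + l • L₀) u‖) :=
    calc |l.im| * (c * ‖u‖ ^ 2) ≤ |l.im| * |reForm (S * L₀) u| :=
          mul_le_mul_of_nonneg_left ((hpos u).trans (le_abs_self _)) (abs_nonneg _)
      _ = |(inner ℂ u (toOp S (toOp (L₁ + l • L₀) u))).im| := by rw [him, abs_mul]
      _ ≤ ‖u‖ * ‖toOp S (toOp (L₁ + l • L₀) u)‖ :=
          (Complex.abs_im_le_norm _).trans (norm_inner_le_norm _ _)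
      _ ≤ ‖u‖ * (M * ‖toOp (L₁ + l • L₀) u‖) :=
          mul_le_mul_of_nonneg_left ((toOp S).le_of_opNorm_le hS _) (norm_nonneg _)
  rw [div_mul_eq_mul_div, le_div_iff₀ hc]
  refine le_of_mul_le_mul_left ?_ hu0
  linarith

/-- A pencil with real roots, with symmetrizers which are positive on the kernels, satisfies a
resolvent bound. -/
theorem pencil_resolvent_bound_of_kernel_symmetrizers {L₀ L₁ : Matrix (Fin N) (Fin N) ℂ}
    {M R G c : ℝ} (hc : 0 < c) (hM : 0 ≤ M) (hR : ‖L₀‖ ≤ R) (hG : ‖L₀⁻¹‖ ≤ G) (hdet : L₀.det ≠ 0)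
    (hreal : ∀ l : ℂ, (L₁ + l • L₀).det = 0 → l.im = 0)
    (hS : ∀ r : ℝ, ∃ S : Matrix (Fin N) (Fin N) ℂ, ‖S‖ ≤ M ∧
      (S * (L₁ + (-r : ℂ) • L₀)).IsHermitian ∧
      ∀ u, toOp (L₁ + (-r : ℂ) • L₀) u = 0 → c * ‖u‖ ^ 2 ≤ reForm (S * L₀) u)
    (l : ℂ) (u : EuclideanSpace ℂ (Fin N)) :
    |l.im| * ‖u‖ ≤ N * (M * R / c) * G * ‖toOp (L₁ + l • L₀) u‖ := by
  have hunit : IsUnit L₀.det := isUnit_iff_ne_zero.2 hdet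
  have hR0 : 0 ≤ R := (norm_nonneg _).trans hR
  choose S hSM hSh hSp using hS
  have hsplit : ∀ (κ : ℂ) v, toOp L₀⁻¹ (toOp (L₁ + κ • L₀) v) = toOp (L₀⁻¹ * L₁) v + κ • v := by
    intro κ v
    rw [toOp_add_smul_apply, map_add, map_smul, ← toOp_mul_apply, ← toOp_mul_apply,
      Matrix.nonsing_inv_mul _ hunit, toOp_one]
    rfl
  have hinj : ∀ v, toOp L₀⁻¹ v = 0 → v = 0 := by
    intro v hv
    have := congrArg (toOp L₀) hv
    rwa [← toOp_mul_apply, Matrix.mul_nonsing_inv _ hunit, map_zero, toOp_one] at this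
  have hker : ∀ (μ : ℂ) v, toOp (L₀⁻¹ * L₁) v = μ • v → toOp (L₁ + (-μ) • L₀) v = 0 := by
    intro μ v hv
    apply hinj
    rw [hsplit, hv, neg_smul, add_neg_cancel]
  have hre : ∀ μ : ℂ, μ.im = 0 → (μ.re : ℂ) = μ := fun μ hμ => Complex.ext (by simp) (by simp [hμ])
  -- With f = L₀⁻¹L₁ and T_μ = S L₀, where S is taken at r = μ, T_μ(f - μ) is the Hermitian matrix
  -- S(L₁ - μL₀).
  have hcancel : ∀ (μ : ℂ), μ.im = 0 → ∀ v, toOp (S μ.re * L₀) (toOp (L₀⁻¹ * L₁) v - μ • v) =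
      toOp (S μ.re * (L₁ + (-μ.re : ℂ) • L₀)) v := by
    intro μ hμ v
    rw [sub_eq_add_neg, ← neg_smul, ← hsplit, ← toOp_mul_apply, ← toOp_mul_apply, hre μ hμ,
      Matrix.mul_assoc, Matrix.mul_assoc, Matrix.mul_nonsing_inv_cancel_left _ _ hunit]
  have key := resolvent_bound_of_symmetrizers (f := toOp (L₀⁻¹ * L₁))
    (T := fun μ => toOp (S μ.re * L₀)) (M := M * R) (c := c) (by positivity) hc
    (fun μ v hv h => ?_) (fun μ _ => ?_) (fun μ hμ v w => ?_) (fun μ hμ v hv => ?_) l u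
  · rw [finrank_euclideanSpace_fin, ← hsplit] at key
    rw [mul_assoc]
    refine key.trans (mul_le_mul_of_nonneg_left ?_ (by positivity))
    exact (toOp L₀⁻¹).le_of_opNorm_le hG _
  · have := hreal (-μ) ((det_eq_zero_iff_exists_toOp _).2 ⟨v, hv, hker μ v h⟩)
    simpa using this
  · exact (Matrix.l2_opNorm_mul _ _).trans (mul_le_mul (hSM _) hR (norm_nonneg _) hM)
  · rw [hcancel μ hμ, hcancel μ hμ, inner_toOp_of_isHermitian (hSh _)]
  · exact hSp _ v (by rw [hre μ hμ]; exact hker μ v hv)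

end MatrixBounds

/-! ### Algebra of the symbol; hyperbolicity in terms of roots and of resolvents. -/

section Symbols

variable {N d : ℕ}

theorem realSymbol_add (A : Fin (d + 1) → Matrix (Fin N) (Fin N) ℂ)
    (ξ η : EuclideanSpace ℝ (Fin (d + 1))) :
    realSymbol A (ξ + η) = realSymbol A ξ + realSymbol A η := by
  simp [realSymbol, symbol, add_smul, Finset.sum_add_distrib]

theorem realSymbol_smul (A : Fin (d + 1) → Matrix (Fin N) (Fin N) ℂ) (t : ℝ)
    (ξ : EuclideanSpace ℝ (Fin (d + 1))) : realSymbol A (t • ξ) = (t : ℂ) • realSymbol A ξ := by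
  simp [realSymbol, symbol, Finset.smul_sum, smul_smul, -Complex.coe_smul]

theorem realSymbol_zero (A : Fin (d + 1) → Matrix (Fin N) (Fin N) ℂ) : realSymbol A 0 = 0 := by
  simp [realSymbol, symbol]

theorem symbol_add_mul (A : Fin (d + 1) → Matrix (Fin N) (Fin N) ℂ)
    (ξ ν : EuclideanSpace ℝ (Fin (d + 1))) (l : ℂ) :
    symbol A (fun j => (ξ j : ℂ) + l * (ν j : ℂ)) = realSymbol A ξ + l • realSymbol A ν := by
  simp [realSymbol, symbol, add_smul, Finset.sum_add_distrib, Finset.smul_sum, smul_smul,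
    -Complex.coe_smul]

theorem symbol_mul_left (A : Fin (d + 1) → Matrix (Fin N) (Fin N) ℂ) (l : ℂ)
    (ζ : Fin (d + 1) → ℂ) : symbol A (fun j => l * ζ j) = l • symbol A ζ := by
  simp [symbol, Finset.smul_sum, smul_smul]

theorem charDet_zero (A : Fin (d + 1) → Matrix (Fin N) (Fin N) ℂ) (ζ : Fin (d + 1) → ℂ) :
    charDet A 0 ζ = Complex.I ^ N * (symbol A ζ).det := by
  rw [charDet, add_zero, symbol_mul_left, Matrix.det_smul, Fintype.card_fin]

/-- For B = 0 the roots scale with the covector, so a single nonreal root could be moved beyond any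
γ₀; the strip collapses to the real axis. -/
theorem isHyperbolic_zero_iff (A : Fin (d + 1) → Matrix (Fin N) (Fin N) ℂ)
    (ν : EuclideanSpace ℝ (Fin (d + 1))) :
    IsHyperbolic A 0 ν ↔ (realSymbol A ν).det ≠ 0 ∧
      ∀ (ξ : EuclideanSpace ℝ (Fin (d + 1))) (l : ℂ),
        (realSymbol A ξ + l • realSymbol A ν).det = 0 → l.im = 0 := by
  have hI : (Complex.I : ℂ) ^ N ≠ 0 := pow_ne_zero _ Complex.I_ne_zero
  have hsym : ∀ (ξ : EuclideanSpace ℝ (Fin (d + 1))) (τ : ℝ),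
      charDet A 0 (fun j => Complex.I * (τ : ℂ) * (ν j : ℂ) + (ξ j : ℂ)) =
        Complex.I ^ N * (realSymbol A ξ + (Complex.I * (τ : ℂ)) • realSymbol A ν).det := by
    intro ξ τ
    rw [charDet_zero, ← symbol_add_mul]
    simp_rw [add_comm]
  rw [IsHyperbolic, charDet_zero]
  refine and_congr ⟨fun h => (mul_ne_zero_iff.1 h).2, fun h => mul_ne_zero hI h⟩ ⟨?_, ?_⟩
  · rintro ⟨γ, hγ⟩ ξ l hl
    by_contra him
    -- The dilation that brings the imaginary part of the root to modulus |γ| + 1.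
    set t : ℝ := (|γ| + 1) / |l.im| with ht
    have hlim : 0 < |l.im| := abs_pos.2 him
    refine hγ (t • (ξ + l.re • ν)) (t * l.im) ?_ ?_
    · rw [abs_mul, abs_of_nonneg (by positivity : 0 ≤ t), ht, div_mul_cancel₀ _ hlim.ne']
      linarith [le_abs_self γ]
    · have h1 : realSymbol A (t • (ξ + l.re • ν)) +
          (Complex.I * ((t * l.im : ℝ) : ℂ)) • realSymbol A ν =
          (t : ℂ) • (realSymbol A ξ + l • realSymbol A ν) := by
        rw [realSymbol_smul, realSymbol_add, realSymbol_smul]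
        conv_rhs => rw [← Complex.re_add_im l]
        push_cast
        module
      rw [hsym, h1, Matrix.det_smul, hl, mul_zero, mul_zero]
  · intro h
    refine ⟨0, fun ξ τ hτ => ?_⟩
    rw [hsym]
    refine mul_ne_zero hI fun h0 => ?_
    have := h ξ _ h0
    simp at this
    simp [this] at hτ

theorem exists_norm_realSymbol_le {𝒜 : Type*} {A : 𝒜 → Fin (d + 1) → Matrix (Fin N) (Fin N) ℂ}
    {ν : 𝒜 → EuclideanSpace ℝ (Fin (d + 1))} (hA : ∃ R : ℝ, ∀ a j, ‖A a j‖ ≤ R)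
    (hν : ∃ R : ℝ, ∀ a, ‖ν a‖ ≤ R) : ∃ R : ℝ, ∀ a, ‖realSymbol (A a) (ν a)‖ ≤ R := by
  obtain ⟨R₁, h₁⟩ := hA
  obtain ⟨R₂, h₂⟩ := hν
  refine ⟨∑ _j : Fin (d + 1), R₂ * R₁, fun a => ?_⟩
  rw [realSymbol, symbol]
  refine norm_sum_le_of_le _ fun j _ => ?_
  rw [norm_smul, Complex.norm_real]
  exact mul_le_mul ((PiLp.norm_apply_le _ _).trans (h₂ a)) (h₁ a j) (norm_nonneg _)
    ((norm_nonneg _).trans (h₂ a))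

/-- Uniform strong hyperbolicity is a uniform resolvent bound. -/
theorem uniformlyStronglyHyperbolic_iff {𝒜 : Type*}
    (A : 𝒜 → Fin (d + 1) → Matrix (Fin N) (Fin N) ℂ) (ν : 𝒜 → EuclideanSpace ℝ (Fin (d + 1))) :
    UniformlyStronglyHyperbolic A ν ↔ DetBoundedBelow A ν ∧ ∃ C : ℝ, 0 ≤ C ∧
      ∀ a ξ (l : ℂ) u, |l.im| * ‖u‖ ≤
        C * ‖toOp (realSymbol (A a) ξ + l • realSymbol (A a) (ν a)) u‖ := by
  refine and_congr_right fun _ => ⟨?_, ?_⟩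
  · rintro ⟨C, hC⟩
    refine ⟨|C|, abs_nonneg C, fun a ξ l u => mul_norm_le_of_singular_perturbation ?_ u⟩
    intro B hB
    rw [← symbol_add_mul] at hB
    exact (hC a ξ B l hB).trans (mul_le_mul_of_nonneg_right (le_abs_self C) (norm_nonneg _))
  · rintro ⟨C, hC0, hC⟩
    refine ⟨C, fun a ξ B l hB => ?_⟩
    rw [symbol_add_mul] at hB
    exact le_mul_norm_of_singular_perturbation hC0 (hC a ξ l) hB

end Symbols

/-! ### Uniform statements for families. -/

section Families

variable {N d : ℕ} {𝒜 : Type*} {A : 𝒜 → Fin (d + 1) → Matrix (Fin N) (Fin N) ℂ}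
  {ν : 𝒜 → EuclideanSpace ℝ (Fin (d + 1))}

theorem UniformlyStronglyHyperbolic.isHyperbolic (h : UniformlyStronglyHyperbolic A ν) (a : 𝒜) :
    IsHyperbolic (A a) 0 (ν a) := by
  obtain ⟨⟨c, hc, hdet⟩, C, hC⟩ := h
  refine (isHyperbolic_zero_iff _ _).2 ⟨norm_pos_iff.1 (hc.trans_le (hdet a)), fun ξ l hl => ?_⟩
  have := hC a ξ 0 l (by rw [add_zero, symbol_add_mul, hl])
  rw [norm_zero, mul_zero] at this
  exact abs_eq_zero.1 (le_antisymm this (abs_nonneg _))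

/-- A uniformly strongly hyperbolic family has bounded symmetrizers at all real frequencies. -/
theorem UniformlyStronglyHyperbolic.exists_isSymmetrizer_top (hA : ∃ R : ℝ, ∀ a j, ‖A a j‖ ≤ R)
    (hν : ∃ R : ℝ, ∀ a, ‖ν a‖ ≤ R) (h : UniformlyStronglyHyperbolic A ν) :
    ∃ (M c : ℝ) (S : 𝒜 → EuclideanSpace ℝ (Fin (d + 1)) → Matrix (Fin N) (Fin N) ℂ), 0 < c ∧
      ∀ a ξ, ‖S a ξ‖ ≤ M ∧ (∀ t : ℝ, 0 < t → S a (t • ξ) = S a ξ) ∧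
        (S a ξ * realSymbol (A a) ξ).IsHermitian ∧
        (S a ξ * realSymbol (A a) (ν a)).IsHermitian ∧
        ∀ u, c * ‖u‖ ^ 2 ≤ reForm (S a ξ * realSymbol (A a) (ν a)) u := by
  obtain ⟨⟨c, hc, hdet⟩, C, hC0, hC⟩ := (uniformlyStronglyHyperbolic_iff A ν).1 h
  obtain ⟨R, hR⟩ := exists_norm_realSymbol_le hA hν
  obtain ⟨G, -, hG⟩ := exists_norm_inv_le (N := N) R c hc
  choose S hSn hS₁ hS₀ hSp using fun a ξ => exists_pencil_symmetrizer hC0 (hR a)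
    (hG _ (hR a) (hdet a)) (norm_pos_iff.1 (hc.trans_le (hdet a))) (hC a ξ)
  -- The pointwise choices are unrelated along a ray; evaluating at ξ/|ξ| makes them homogeneous of
  -- degree 0.
  refine ⟨N * (C * R) ^ 2 * G, 1 / ((N : ℝ) + 1), fun a ξ => S a (‖ξ‖⁻¹ • ξ), by positivity,
    fun a ξ => ⟨hSn _ _, fun t ht => ?_, ?_, hS₀ _ _, hSp _ _⟩⟩
  · have : ‖t • ξ‖⁻¹ • t • ξ = ‖ξ‖⁻¹ • ξ := by
      rw [norm_smul, Real.norm_of_nonneg ht.le, smul_smul, mul_inv]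
      congr 1
      field_simp
    simp only [this]
  · rcases eq_or_ne ξ 0 with rfl | hξ
    · rw [realSymbol_zero, Matrix.mul_zero]
      exact Matrix.isHermitian_zero
    · have h1 : realSymbol (A a) ξ = ((‖ξ‖ : ℝ) : ℂ) • realSymbol (A a) (‖ξ‖⁻¹ • ξ) := by
        rw [← realSymbol_smul, smul_smul, mul_inv_cancel₀ (norm_ne_zero_iff.2 hξ), one_smul]
      rw [h1, Matrix.mul_smul]
      exact IsSelfAdjoint.smul (Complex.conj_ofReal _) (hS₁ a _)

/-- Uniform symmetrizers on a complement of the directions yield uniform strong hyperbolicity. -/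
theorem IsUniformSymmetrizerFamily.uniformlyStronglyHyperbolic (hd : 1 ≤ d)
    {E : Submodule ℝ (EuclideanSpace ℝ (Fin (d + 1)))}
    (hE : ∀ a, IsCompl E (Submodule.span ℝ {ν a}))
    {S : 𝒜 → E → Matrix (Fin N) (Fin N) ℂ} (hS : IsUniformSymmetrizerFamily A ν E S) :
    UniformlyStronglyHyperbolic A ν := by
  obtain ⟨M, c, hc, hS⟩ := hS
  -- With E = 0 the symmetrizer conditions would be vacuous; d ≥ 1 excludes this by dimension.
  have hne : ∀ _ : 𝒜, ∃ e : E, e ≠ 0 := by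
    intro a
    by_contra! h
    have hbot : E = ⊥ := (Submodule.eq_bot_iff E).2 fun x hx => congrArg Subtype.val (h ⟨x, hx⟩)
    have htop := (hE a).sup_eq_top
    rw [hbot, bot_sup_eq] at htop
    have h1 := finrank_span_le_card (R := ℝ) ({ν a} : Set (EuclideanSpace ℝ (Fin (d + 1))))
    rw [htop, finrank_top, finrank_euclideanSpace_fin, Set.toFinset_singleton,
      Finset.card_singleton] at h1
    omega
  have key : ∀ a ξ (l : ℂ) u, |l.im| * ‖u‖ ≤
      M / c * ‖toOp (realSymbol (A a) ξ + l • realSymbol (A a) (ν a)) u‖ := by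
    intro a ξ l u
    -- Writing ξ = e + sν only shifts l by the real number s, so Im l is unchanged and frequencies
    -- in E suffice.
    obtain ⟨e, he, x, hx, rfl⟩ := Submodule.mem_sup.1
      ((hE a).sup_eq_top ▸ (Submodule.mem_top : ξ ∈ ⊤))
    obtain ⟨s, rfl⟩ := Submodule.mem_span_singleton.1 hx
    have h1 : realSymbol (A a) (e + s • ν a) + l • realSymbol (A a) (ν a) =
        realSymbol (A a) e + (l + s) • realSymbol (A a) (ν a) := by
      rw [realSymbol_add, realSymbol_smul, add_smul]; abel
    have h2 : l.im = (l + s).im := by simp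
    rw [h1, h2]
    by_cases h0 : (⟨e, he⟩ : E) = 0
    -- At e = 0 the first symmetry condition is trivial, so the symmetrizer of any nonzero frequency
    -- will do.
    · obtain ⟨e₀, he₀⟩ := hne a
      have : e = 0 := congrArg Subtype.val h0
      rw [this, realSymbol_zero]
      exact pencil_resolvent_bound_of_symmetrizer hc ((hS a).bounded e₀ he₀)
        (by rw [Matrix.mul_zero]; exact Matrix.isHermitian_zero)
        ((hS a).selfAdjoint_direction e₀ he₀) ((hS a).positive e₀ he₀) _ _
    · exact pencil_resolvent_bound_of_symmetrizer hc ((hS a).bounded _ h0)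
        ((hS a).selfAdjoint _ h0) ((hS a).selfAdjoint_direction _ h0) ((hS a).positive _ h0) _ _
  refine (uniformlyStronglyHyperbolic_iff A ν).2 ⟨?_, |M / c|, abs_nonneg _, fun a ξ l u =>
    (key a ξ l u).trans (mul_le_mul_of_nonneg_right (le_abs_self _) (norm_nonneg _))⟩
  obtain ⟨δ, hδ, hdet⟩ := exists_le_norm_det N (M / c)
  refine ⟨δ, hδ, fun a => hdet _ fun u => ?_⟩
  -- At ξ = 0 and l = i the estimate reads |u| ≤ (M/c)|L(ν)u|, which bounds the determinant below.
  have := key a 0 Complex.I u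
  rwa [realSymbol_zero, toOp_add_smul_apply, toOp, map_zero, zero_apply, zero_add, norm_smul,
    Complex.norm_I, one_mul, Complex.I_im, abs_one, one_mul] at this

/-- Hyperbolicity and uniformly positive full symmetrizers yield uniform strong hyperbolicity. -/
theorem IsUniformFullSymmetrizerFamily.uniformlyStronglyHyperbolic
    (hA : ∃ R : ℝ, ∀ a j, ‖A a j‖ ≤ R) (hν : ∃ R : ℝ, ∀ a, ‖ν a‖ ≤ R)
    (hyp : ∀ a, IsHyperbolic (A a) 0 (ν a)) (hdet : DetBoundedBelow A ν)
    {S : 𝒜 → EuclideanSpace ℝ (Fin (d + 1)) → Matrix (Fin N) (Fin N) ℂ}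
    (hS : IsUniformFullSymmetrizerFamily A ν S) : UniformlyStronglyHyperbolic A ν := by
  refine (uniformlyStronglyHyperbolic_iff A ν).2 ⟨hdet, ?_⟩
  obtain ⟨M, c, hc, hS⟩ := hS
  obtain ⟨δ, hδ, hdet⟩ := hdet
  obtain ⟨R, hR⟩ := exists_norm_realSymbol_le hA hν
  obtain ⟨G, hG0, hG⟩ := exists_norm_inv_le (N := N) R δ hδ
  refine ⟨N * (max M (c * G) * |R| / c) * G, by positivity, fun a ξ l u => ?_⟩
  obtain ⟨hd0, hreal⟩ := (isHyperbolic_zero_iff _ _).1 (hyp a)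
  refine pencil_resolvent_bound_of_kernel_symmetrizers hc (le_max_of_le_right (by positivity))
    ((hR a).trans (le_abs_self R)) (hG _ (hR a) (hdet a)) hd0 (hreal ξ) (fun r => ?_) l u
  have h1 : realSymbol (A a) ξ + (-r : ℂ) • realSymbol (A a) (ν a) =
      realSymbol (A a) (ξ + (-r) • ν a) := by
    rw [realSymbol_add, realSymbol_smul, Complex.ofReal_neg]
  rw [h1]
  -- No symmetrizer is given at the zero covector. There c L(ν)⁻¹ serves: L(0) = 0 makes the
  -- symmetry trivial, and positivity holds with constant c. Its norm is at most cG, whence the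
  -- maximum in the constant.
  by_cases h0 : ξ + (-r) • ν a = 0
  · refine ⟨(c : ℂ) • (realSymbol (A a) (ν a))⁻¹, ?_, ?_, fun u _ => ?_⟩
    · rw [norm_smul, Complex.norm_real, Real.norm_of_nonneg hc.le]
      exact le_max_of_le_right (mul_le_mul_of_nonneg_left (hG _ (hR a) (hdet a)) hc.le)
    · rw [h0, realSymbol_zero, Matrix.mul_zero]
      exact Matrix.isHermitian_zero
    · rw [Matrix.smul_mul, Matrix.nonsing_inv_mul _ (isUnit_iff_ne_zero.2 hd0)]
      change _ ≤ (inner ℂ u (toOp ((c : ℂ) • 1) u)).re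
      rw [toOp, map_smul, map_one, smul_apply, one_apply_eq_self, inner_smul_right,
        inner_self_eq_norm_sq_to_K]
      simp [← Complex.ofReal_pow]
  · exact ⟨S a _, le_max_of_le_left ((hS a).bounded _ h0), (hS a).selfAdjoint _ h0,
      (hS a).positive _ h0⟩

end Families

end StrongHyp

theorem mainTheorem5 {N d : ℕ} {𝒜 : Type*}
    (A : 𝒜 → Fin (d + 1) → Matrix (Fin N) (Fin N) ℂ)
    (ν : 𝒜 → EuclideanSpace ℝ (Fin (d + 1)))
    (hA : ∃ R : ℝ, ∀ a j, ‖A a j‖ ≤ R)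
    (hν : ∃ R : ℝ, ∀ a, ‖ν a‖ ≤ R) :
    (1 ≤ d → ∀ E : Submodule ℝ (EuclideanSpace ℝ (Fin (d + 1))),
      StrongHyp.UniformDecomposition ν E →
        (StrongHyp.UniformlyStronglyHyperbolic A ν ↔
          ∃ S : 𝒜 → E → Matrix (Fin N) (Fin N) ℂ,
            StrongHyp.IsUniformSymmetrizerFamily A ν E S)) ∧
    (StrongHyp.UniformlyStronglyHyperbolic A ν ↔
      ((∀ a, StrongHyp.IsHyperbolic (A a) 0 (ν a)) ∧ StrongHyp.DetBoundedBelow A ν) ∧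
        ∃ S : 𝒜 → EuclideanSpace ℝ (Fin (d + 1)) → Matrix (Fin N) (Fin N) ℂ,
          StrongHyp.IsUniformFullSymmetrizerFamily A ν S) := by
  refine ⟨fun hd E hE => ⟨fun h => ?_, ?_⟩, fun h => ?_, ?_⟩
  · obtain ⟨M, c, S, hc, hS⟩ := h.exists_isSymmetrizer_top hA hν
    exact ⟨fun a ξ => S a ξ, M, c, hc, fun a =>
      ⟨fun ξ _ => (hS a ξ).1, fun ξ _ t ht => (hS a ξ).2.1 t ht, fun ξ _ => (hS a ξ).2.2.1,
        fun ξ _ => (hS a ξ).2.2.2.1, fun ξ _ => (hS a ξ).2.2.2.2⟩⟩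
  · rintro ⟨S, hS⟩
    exact hS.uniformlyStronglyHyperbolic hd hE.1
  · obtain ⟨M, c, S, hc, hS⟩ := h.exists_isSymmetrizer_top hA hν
    exact ⟨⟨h.isHyperbolic, h.1⟩, S, M, c, hc, fun a =>
      ⟨fun ξ _ => (hS a ξ).1, fun ξ _ t ht => (hS a ξ).2.1 t ht, fun ξ _ => (hS a ξ).2.2.1,
        fun ξ _ u _ => (hS a ξ).2.2.2.2 u⟩⟩
  · rintro ⟨⟨hyp, hdet⟩, S, hS⟩
    exact hS.uniformlyStronglyHyperbolic hA hν hyp hdet
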